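/- Let $(\Omega_n)_{n\in\mathbb N}$ be an increasing sequence of open subsets of $\mathbb R^d$ and let $\Omega := \bigcup_{n\in\mathbb N}\Omega_n$. Fix $\lambda>0$ and $f\in L_2(\Omega)$ (functions are complex-valued). For an open set $U\subseteq\mathbb R^d$ let $H^1_0(U)$ be the closure of $C_c^\infty(U)$ in $H^1(\mathbb R^d)$, where functions on $U$ are identified with their extensions by zero to $\mathbb R^d$. A weak solution of the Dirichlet problem $\lambda w-\Delta w=f$ in $U$, $w=0$ on $\partial U$, is a function $w\in H^1_0(U)$ such that $$\lambda\int_U w\,\overline v+\int_U\nabla w\cdot\overline{\nabla v}=\int_U f\,\overline v\qquad\text{for all } v\in H^1_0(U).$$ Then for every $n\in\mathbb N$ the Dirichlet problem $$\lambda u_n-\Delta u_n=f\ \text{ in }\Omega_n,\qquad u_n=0\ \text{ on }\partial\Omega_n,$$ has a unique weak solution $u_n\in H^1_0(\Omega_n)$, the Dirichlet problem $$\lambda u-\Delta u=f\ \text{ in }\Omega,\qquad u=0\ \text{ on }\partial\Omega,$$ has a unique weak solution $u\in H^1_0(\Omega)$, and $$\lim_{n\to\infty}\|u_n-u\|_{L_2(\mathbb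 R^d)}=0.$$ -/

import Mathlib

open MeasureTheory Filter Topology TopologicalSpace
open scoped Distributions

noncomputable section

/-- The space `L₂(ℝᵈ)` of complex-valued square integrable functions. -/
abbrev L2Space (d : ℕ) : Type :=
  Lp ℂ 2 (volume : Measure (EuclideanSpace ℝ (Fin d)))

/-- The classical partial derivative `∂ᵢ φ`. -/
def partialDeriv {d : ℕ} (i : Fin d) (φ : EuclideanSpace ℝ (Fin d) → ℂ)
    (x : EuclideanSpace ℝ (Fin d)) : ℂ :=
  fderiv ℝ φ x (EuclideanSpace.single i 1)

/-- `g` is the weak (distributional) `i`-th partial derivative of `u` on `ℝᵈ`. Note that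
`𝓓(⊤, ℂ)` is the space `C_c^∞(ℝᵈ)`. -/
def HasWeakPartialDeriv {d : ℕ} (i : Fin d) (u g : L2Space d) : Prop :=
  ∀ φ : 𝓓((⊤ : Opens (EuclideanSpace ℝ (Fin d))), ℂ),
    ∫ x, u x * partialDeriv i φ x = -∫ x, g x * φ x

/-- An `L₂` function is integrable against continuous functions with compact support. -/
lemma integrable_L2Space_mul {d : ℕ} (u : L2Space d) {ψ : EuclideanSpace ℝ (Fin d) → ℂ}
    (hψ : Continuous ψ) (hc : HasCompactSupport ψ) : Integrable (fun x => u x * ψ x) :=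
  MemLp.integrable_mul (p := 2) (q := 2) (Lp.memLp u) (hψ.memLp_of_hasCompactSupport hc)

lemma continuous_partialDeriv {d : ℕ} (i : Fin d)
    (φ : 𝓓((⊤ : Opens (EuclideanSpace ℝ (Fin d))), ℂ)) : Continuous (partialDeriv i φ) :=
  (φ.contDiff.continuous_fderiv (by simp)).clm_apply continuous_const

lemma hasCompactSupport_partialDeriv {d : ℕ} (i : Fin d)
    (φ : 𝓓((⊤ : Opens (EuclideanSpace ℝ (Fin d))), ℂ)) : HasCompactSupport (partialDeriv i φ) :=
  φ.hasCompactSupport.fderiv_apply (𝕜 := ℝ) _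

lemma HasWeakPartialDeriv.zero {d : ℕ} (i : Fin d) :
    HasWeakPartialDeriv i (0 : L2Space d) 0 := by
  intro φ
  have h : ∀ ψ : EuclideanSpace ℝ (Fin d) → ℂ,
      ∫ x, (0 : L2Space d) x * ψ x = 0 := fun ψ => by
    rw [integral_congr_ae (g := fun _ => (0 : ℂ)), integral_zero]
    filter_upwards [Lp.coeFn_zero ℂ 2 (volume : Measure (EuclideanSpace ℝ (Fin d)))] with x hx
    simp
  rw [h, h, neg_zero]

lemma HasWeakPartialDeriv.add {d : ℕ} {i : Fin d} {u v g h : L2Space d}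
    (hu : HasWeakPartialDeriv i u g) (hv : HasWeakPartialDeriv i v h) :
    HasWeakPartialDeriv i (u + v) (g + h) := by
  intro φ
  have key : ∀ (a b : L2Space d) {ψ : EuclideanSpace ℝ (Fin d) → ℂ}, Continuous ψ →
      HasCompactSupport ψ → ∫ x, (a + b) x * ψ x = (∫ x, a x * ψ x) + ∫ x, b x * ψ x := by
    intro a b ψ h1 h2
    rw [← integral_add (integrable_L2Space_mul a h1 h2) (integrable_L2Space_mul b h1 h2)]
    refine integral_congr_ae ?_
    filter_upwards [Lp.coeFn_add a b] with x hx
    simp only [hx, Pi.add_apply, add_mul]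
  rw [key u v (continuous_partialDeriv i φ) (hasCompactSupport_partialDeriv i φ),
    key g h φ.continuous φ.hasCompactSupport, hu φ, hv φ, neg_add]

lemma HasWeakPartialDeriv.smul {d : ℕ} {i : Fin d} {u g : L2Space d} (c : ℂ)
    (hu : HasWeakPartialDeriv i u g) : HasWeakPartialDeriv i (c • u) (c • g) := by
  intro φ
  have key : ∀ (a : L2Space d) (ψ : EuclideanSpace ℝ (Fin d) → ℂ),
      ∫ x, (c • a) x * ψ x = c * ∫ x, a x * ψ x := by
    intro a ψ
    rw [← integral_const_mul]
    refine integral_congr_ae ?_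
    filter_upwards [Lp.coeFn_smul c a] with x hx
    simp only [hx, Pi.smul_apply, smul_eq_mul, mul_assoc]
  rw [key, key, hu φ, mul_neg]

/-- The Sobolev space `H¹(ℝᵈ)` of all `u ∈ L₂(ℝᵈ)` whose weak partial derivatives exist in
`L₂(ℝᵈ)`. A function `u` is stored together with its (unique) weak gradient, as the pair `(u, ∇u)`
in the Hilbert space `L₂(ℝᵈ) × L₂(ℝᵈ)ᵈ`, so that the norm is the usual one,
`‖u‖² = ‖u‖²_{L₂} + ∑ᵢ ‖∂ᵢu‖²_{L₂}`. -/
def SobolevH1 (d : ℕ) :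
    Submodule ℂ (WithLp 2 (L2Space d × PiLp 2 (fun _ : Fin d => L2Space d))) where
  carrier := {U | ∀ i, HasWeakPartialDeriv i U.fst (U.snd i)}
  zero_mem' := fun i => HasWeakPartialDeriv.zero i
  add_mem' := fun hU hV i => (hU i).add (hV i)
  smul_mem' := fun c _ hU i => (hU i).smul c

/-- The underlying `L₂` function `u` of `u ∈ H¹(ℝᵈ)`. -/
def sobolevFun {d : ℕ} (u : SobolevH1 d) : L2Space d := u.1.fst

/-- The weak partial derivative `∂ᵢu` of `u ∈ H¹(ℝᵈ)`. -/
def weakDeriv {d : ℕ} (u : SobolevH1 d) (i : Fin d) : L2Space d := u.1.snd i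

/-- `C_c^∞(Ω)` as a subspace of `H¹(ℝᵈ)` (functions on `Ω` are extended by zero). -/
def testFunctionsH1 {d : ℕ} (Ω : Opens (EuclideanSpace ℝ (Fin d))) :
    Submodule ℂ (SobolevH1 d) where
  carrier := {u | ∃ φ : 𝓓(Ω, ℂ), sobolevFun u =ᵐ[volume] φ}
  zero_mem' := ⟨0, by
    exact Lp.coeFn_zero ℂ 2 (volume : Measure (EuclideanSpace ℝ (Fin d)))⟩
  add_mem' := by
    rintro u v ⟨φ, hφ⟩ ⟨ψ, hψ⟩
    refine ⟨φ + ψ, (Lp.coeFn_add (sobolevFun u) (sobolevFun v)).trans ?_⟩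
    filter_upwards [hφ, hψ] with x h1 h2
    simp [h1, h2]
  smul_mem' := by
    rintro c u ⟨φ, hφ⟩
    refine ⟨c • φ, (Lp.coeFn_smul c (sobolevFun u)).trans ?_⟩
    filter_upwards [hφ] with x h1
    simp [h1]

/-- The Sobolev space `H¹₀(Ω)`, the closure of `C_c^∞(Ω)` in `H¹(ℝᵈ)`. Its elements are functions
on `ℝᵈ` (extension by zero outside `Ω`). -/
def SobolevH10 {d : ℕ} (Ω : Opens (EuclideanSpace ℝ (Fin d))) : Submodule ℂ (SobolevH1 d) :=
  (testFunctionsH1 Ω).topologicalClosure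

/-- `u` is a weak solution of the Dirichlet problem `lam • u - Δu = f` in `Ω`, `u = 0` on `∂Ω`:
`u ∈ H¹₀(Ω)` and
`lam ∫_Ω u conj(v) + ∫_Ω ∇u · conj(∇v) = ∫_Ω f conj(v)` for all `v ∈ H¹₀(Ω)`. -/
def IsWeakDirichletSolution {d : ℕ} (Ω : Opens (EuclideanSpace ℝ (Fin d))) (lam : ℝ)
    (f : EuclideanSpace ℝ (Fin d) → ℂ) (u : SobolevH1 d) : Prop :=
  u ∈ SobolevH10 Ω ∧ ∀ v ∈ SobolevH10 Ω,
    (lam : ℂ) * (∫ x in (Ω : Set (EuclideanSpace ℝ (Fin d))),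
        sobolevFun u x * (starRingEnd ℂ) (sobolevFun v x)) +
      ∑ i, (∫ x in (Ω : Set (EuclideanSpace ℝ (Fin d))),
        weakDeriv u i x * (starRingEnd ℂ) (weakDeriv v i x)) =
      ∫ x in (Ω : Set (EuclideanSpace ℝ (Fin d))), f x * (starRingEnd ℂ) (sobolevFun v x)

end

/-!
The map `T u = (√lam u, ∇u)` is bounded below on `H¹(ℝᵈ)` and turns the Dirichlet form into an inner
product, so the weak solution in an open set `U` is the preimage under `T` of the orthogonal
projection of one fixed vector onto `T (H¹₀(U))`. A test function on `⋃ Ωₙ` has compact support,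
hence is already a test function on some `Ωₙ`; therefore `⋃ H¹₀(Ωₙ)` is dense in `H¹₀(⋃ Ωₙ)`, and
Céa's lemma shows that the projections converge.
-/

section LeastSquares

variable {𝕜 E H : Type*} [RCLike 𝕜] [NormedAddCommGroup E] [NormedSpace 𝕜 E]
  [NormedAddCommGroup H] [InnerProductSpace 𝕜 H] {T : E →L[𝕜] H} {F : H}

/-- The abstract variational problem: `u ∈ K` minimises `‖T u - F‖` over the subspace `K`. This is
encoded by the normal equations, which have the shape of a weak formulation. -/
def IsLeastSquaresSolution (T : E →L[𝕜] H) (F : H) (K : Submodule 𝕜 E) (u : E) : Prop :=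
  u ∈ K ∧ ∀ v ∈ K, inner 𝕜 (T v) (T u) = inner 𝕜 (T v) F

lemma exists_isLeastSquaresSolution (T : E →L[𝕜] H) (F : H) (K : Submodule 𝕜 E)
    [(K.map (T : E →ₗ[𝕜] H)).HasOrthogonalProjection] :
    ∃ u, IsLeastSquaresSolution T F K u := by
  obtain ⟨u, hu, hTu⟩ := Submodule.starProjection_apply_mem (K.map (T : E →ₗ[𝕜] H)) F
  refine ⟨u, hu, fun v hv => ?_⟩
  rw [eq_comm, ← sub_eq_zero, ← inner_sub_right, ← ContinuousLinearMap.coe_coe T, hTu]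
  exact Submodule.inner_right_of_mem_orthogonal (Submodule.mem_map_of_mem hv)
    (Submodule.sub_starProjection_mem_orthogonal F)

/-- Céa's lemma. -/
lemma IsLeastSquaresSolution.norm_map_sub_le {K L : Submodule 𝕜 E} {u v w : E} (hKL : K ≤ L)
    (hu : IsLeastSquaresSolution T F K u) (hw : IsLeastSquaresSolution T F L w) (hv : v ∈ K) :
    ‖T u - T w‖ ≤ ‖T v - T w‖ := by
  have galerkin_orthogonality : inner 𝕜 (T v - T u) (T u - T w) = 0 := by
    have hvu : v - u ∈ K := K.sub_mem hv hu.1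
    rw [← map_sub, inner_sub_right, hu.2 _ hvu, hw.2 _ (hKL hvu), sub_self]
  have pythagoras :=
    norm_add_sq_eq_norm_sq_add_norm_sq_of_inner_eq_zero _ _ galerkin_orthogonality
  rw [sub_add_sub_cancel] at pythagoras
  nlinarith [norm_nonneg (T v - T w), norm_nonneg (T u - T w), norm_nonneg (T v - T u)]

lemma IsLeastSquaresSolution.eq {K : Submodule 𝕜 E} {u w : E} (hT : Function.Injective T)
    (hu : IsLeastSquaresSolution T F K u) (hw : IsLeastSquaresSolution T F K w) : u = w := by
  have h := hu.norm_map_sub_le le_rfl hw hw.1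
  rw [sub_self, norm_zero, norm_le_zero_iff, sub_eq_zero] at h
  exact hT h

lemma existsUnique_isLeastSquaresSolution [CompleteSpace E] {c : NNReal}
    (hT : AntilipschitzWith c T) (F : H) {K : Submodule 𝕜 E} (hK : IsClosed (K : Set E)) :
    ∃! u, IsLeastSquaresSolution T F K u := by
  have hTK : IsComplete (K.map (T : E →ₗ[𝕜] H) : Set H) :=
    (isComplete_image_iff (hT.isUniformInducing T.uniformContinuous)).2 hK.isComplete
  have := hTK.completeSpace_coe
  obtain ⟨u, hu⟩ := exists_isLeastSquaresSolution T F K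
  exact ⟨u, hu, fun w hw => hw.eq hT.injective hu⟩

lemma tendsto_of_isLeastSquaresSolution {ι : Type*} [Preorder ι] [IsDirectedOrder ι] [Nonempty ι]
    {K : ι → Submodule 𝕜 E} (hK : Monotone K) (hT : IsInducing T) {u : ι → E} {w : E}
    (hu : ∀ i, IsLeastSquaresSolution T F (K i) (u i))
    (hw : IsLeastSquaresSolution T F (⨆ i, K i).topologicalClosure w) :
    Tendsto u atTop (𝓝 w) := by
  rw [hT.tendsto_nhds_iff, Metric.tendsto_nhds]
  intro ε hε
  obtain ⟨v, hvw, hv⟩ : ∃ v, ‖T v - T w‖ < ε ∧ v ∈ ⨆ i, K i :=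
    mem_closure_iff.1 hw.1 {v | ‖T v - T w‖ < ε}
      (isOpen_lt (by fun_prop) continuous_const) (by simpa using hε)
  obtain ⟨i, hvi⟩ := (Submodule.mem_iSup_of_directed K hK.directed_le).1 hv
  filter_upwards [eventually_ge_atTop i] with j hij
  have hKL : K j ≤ (⨆ i, K i).topologicalClosure :=
    (le_iSup K j).trans (Submodule.le_topologicalClosure _)
  rw [Function.comp_apply, dist_eq_norm]
  exact ((hu j).norm_map_sub_le hKL hw (hK hij hvi)).trans_lt hvw

end LeastSquares

section Lp

variable {α 𝕜 F : Type*} [RCLike 𝕜] {m : MeasurableSpace α} {μ : Measure α}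
  [NormedAddCommGroup F] {p q : ENNReal}

lemma continuous_integral_Lp_mul [Fact (1 ≤ p)] [Fact (1 ≤ q)] [p.HolderConjugate q] {ψ : α → 𝕜}
    (hψ : MemLp ψ q μ) : Continuous fun u : Lp 𝕜 p μ => ∫ x, u x * ψ x ∂μ := by
  have h : ∀ u : Lp 𝕜 p μ,
      ∫ x, u x * ψ x ∂μ = (ContinuousLinearMap.mul 𝕜 𝕜).lpPairing μ p q u (hψ.toLp ψ) := by
    intro u
    rw [ContinuousLinearMap.lpPairing_eq_integral]
    refine integral_congr_ae ?_
    filter_upwards [hψ.coeFn_toLp] with x hx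
    rw [ContinuousLinearMap.mul_apply', hx]
  simp_rw [h]
  fun_prop

lemma isClosed_setOf_ae_eq_zero_on [NormedSpace ℝ F] [Fact (1 ≤ p)] {s : Set α}
    (hs : MeasurableSet s) : IsClosed {u : Lp F p μ | ∀ᵐ x ∂μ, x ∈ s → u x = 0} := by
  have h : {u : Lp F p μ | ∀ᵐ x ∂μ, x ∈ s → u x = 0} =
      LpToLpRestrictCLM α F ℝ μ p s ⁻¹' {0} := by
    ext u
    have hu := LpToLpRestrictCLM_coeFn (μ := μ) (p := p) ℝ s u
    rw [Set.mem_ofPred_eq, Set.mem_preimage, Set.mem_singleton_iff, Lp.eq_zero_iff_ae_eq_zero,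
      ← ae_restrict_iff' hs]
    exact ⟨hu.trans, hu.symm.trans⟩
  rw [h]
  exact isClosed_singleton.preimage (ContinuousLinearMap.continuous _)

lemma setIntegral_mul_conj_eq_inner (s : Set α) (u v : Lp 𝕜 2 μ)
    (hv : ∀ᵐ x ∂μ, x ∈ sᶜ → v x = 0) :
    ∫ x in s, u x * (starRingEnd 𝕜) (v x) ∂μ = inner 𝕜 v u := by
  rw [L2.inner_def, setIntegral_eq_integral_of_ae_compl_eq_zero]
  · simp only [RCLike.inner_apply]
  · filter_upwards [hv] with x hx hxs
    rw [hx hxs, map_zero, mul_zero]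

lemma exists_Lp_ae_eq_on {f : α → F} {s : Set α} (hs : MeasurableSet s)
    (hf : MemLp f p (μ.restrict s)) : ∃ g : Lp F p μ, ∀ᵐ x ∂μ, x ∈ s → g x = f x := by
  have hsf : MemLp (s.indicator f) p μ := (memLp_indicator_iff_restrict hs).2 hf
  refine ⟨hsf.toLp _, ?_⟩
  filter_upwards [hsf.coeFn_toLp] with x hx hxs
  rw [hx, Set.indicator_of_mem hxs]

end Lp

section Sobolev

variable {d : ℕ}

lemma integral_mul_partialDeriv_eq_zero {u ψ : EuclideanSpace ℝ (Fin d) → ℂ}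
    {s : Set (EuclideanSpace ℝ (Fin d))} (hu : ∀ᵐ x, x ∈ s → u x = 0) (hψ : tsupport ψ ⊆ s)
    (i : Fin d) : ∫ x, u x * partialDeriv i ψ x = 0 := by
  refine integral_eq_zero_of_ae ?_
  filter_upwards [hu] with x hx
  by_cases hxs : x ∈ s
  · simp only [hx hxs, zero_mul, Pi.zero_apply]
  · have : fderiv ℝ ψ x = 0 :=
      image_eq_zero_of_notMem_tsupport fun h => hxs (hψ (tsupport_fderiv_subset ℝ h))
    simp only [partialDeriv, this, zero_apply, mul_zero, Pi.zero_apply]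

lemma HasWeakPartialDeriv.ae_eq_zero_on {i : Fin d} {u g : L2Space d}
    (h : HasWeakPartialDeriv i u g) {V : Set (EuclideanSpace ℝ (Fin d))} (hV : IsOpen V)
    (hu : ∀ᵐ x, x ∈ V → u x = 0) : ∀ᵐ x, x ∈ V → g x = 0 := by
  have hg : LocallyIntegrable g := (Lp.memLp g).locallyIntegrable (by norm_num)
  refine hV.ae_eq_zero_of_integral_contDiff_smul_eq_zero (hg.locallyIntegrableOn V)
    fun η hη hηc hηV => ?_
  let φ : 𝓓((⊤ : Opens (EuclideanSpace ℝ (Fin d))), ℂ) :=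
    { toFun := fun x => (η x : ℂ)
      contDiff' := Complex.ofRealCLM.contDiff.comp hη
      hasCompactSupport' := hηc.comp_left (g := ((↑) : ℝ → ℂ)) Complex.ofReal_zero
      tsupport_subset' := Set.subset_univ _ }
  have hφV : tsupport φ ⊆ V :=
    (closure_mono (Function.support_comp_subset Complex.ofReal_zero η)).trans hηV
  calc ∫ x, η x • g x = ∫ x, g x * φ x :=
        integral_congr_ae (ae_of_all _ fun x => (Complex.real_smul).trans (mul_comm _ _))
    _ = -∫ x, u x * partialDeriv i φ x := by rw [h φ, neg_neg]
    _ = 0 := by rw [integral_mul_partialDeriv_eq_zero hu hφV, neg_zero]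

/-- The Hilbert space `L₂(ℝᵈ) × L₂(ℝᵈ)ᵈ` of pairs `(u, ∇u)`, in which `H¹(ℝᵈ)` is a subspace. -/
abbrev GraphSpace (d : ℕ) : Type :=
  WithLp 2 (L2Space d × PiLp 2 (fun _ : Fin d => L2Space d))

lemma isClosed_sobolevH1 (d : ℕ) : IsClosed (SobolevH1 d : Set (GraphSpace d)) := by
  have h : (SobolevH1 d : Set (GraphSpace d)) =
      ⋂ (i : Fin d) (φ : 𝓓((⊤ : Opens (EuclideanSpace ℝ (Fin d))), ℂ)),
        {U | ∫ x, U.fst x * partialDeriv i φ x = -∫ x, U.snd i x * φ x} := by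
    ext U
    simp only [Set.mem_iInter]
    rfl
  rw [h]
  refine isClosed_iInter fun i => isClosed_iInter fun φ => isClosed_eq ?_ ?_
  · have hφ : MemLp (partialDeriv i φ) 2 :=
      (continuous_partialDeriv i φ).memLp_of_hasCompactSupport (hasCompactSupport_partialDeriv i φ)
    exact (continuous_integral_Lp_mul hφ).comp (WithLp.fstL 2 ℂ _ _).continuous
  · have hφ : MemLp φ 2 := φ.continuous.memLp_of_hasCompactSupport φ.hasCompactSupport
    exact ((continuous_integral_Lp_mul hφ).comp ((PiLp.proj (𝕜 := ℂ) 2 _ i).continuous.comp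
      (WithLp.sndL 2 ℂ _ _).continuous)).neg

instance : CompleteSpace (SobolevH1 d) :=
  (isClosed_sobolevH1 d).completeSpace_coe

lemma continuous_sobolevFun : Continuous (sobolevFun : SobolevH1 d → L2Space d) :=
  (WithLp.fstL 2 ℂ _ _).continuous.comp continuous_subtype_val

lemma continuous_weakDeriv (i : Fin d) : Continuous fun u : SobolevH1 d => weakDeriv u i :=
  (PiLp.proj (𝕜 := ℂ) 2 _ i).continuous.comp
    ((WithLp.sndL 2 ℂ _ _).continuous.comp continuous_subtype_val)

lemma ae_eq_zero_of_mem_testFunctionsH1 {U : Opens (EuclideanSpace ℝ (Fin d))} {u : SobolevH1 d}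
    (hu : u ∈ testFunctionsH1 U) :
    (∀ᵐ x, x ∈ (U : Set (EuclideanSpace ℝ (Fin d)))ᶜ → sobolevFun u x = 0) ∧
      ∀ i, ∀ᵐ x, x ∈ (U : Set (EuclideanSpace ℝ (Fin d)))ᶜ → weakDeriv u i x = 0 := by
  obtain ⟨φ, hφ⟩ := hu
  have hUφ := Set.compl_subset_compl.2 φ.tsupport_subset
  have hu₀ : ∀ᵐ x, x ∈ (tsupport φ)ᶜ → sobolevFun u x = 0 := by
    filter_upwards [hφ] with x hx hxφ
    rw [hx, image_eq_zero_of_notMem_tsupport hxφ]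
  -- Locality of weak derivatives needs an open set, hence the detour through `(tsupport φ)ᶜ`.
  have hu₁ : ∀ i, ∀ᵐ x, x ∈ (tsupport φ)ᶜ → weakDeriv u i x = 0 := fun i =>
    HasWeakPartialDeriv.ae_eq_zero_on (u.2 i) (isClosed_tsupport φ).isOpen_compl hu₀
  exact ⟨hu₀.mono fun x hx hxU => hx (hUφ hxU),
    fun i => (hu₁ i).mono fun x hx hxU => hx (hUφ hxU)⟩

lemma ae_eq_zero_of_mem_sobolevH10 {U : Opens (EuclideanSpace ℝ (Fin d))} {u : SobolevH1 d}
    (hu : u ∈ SobolevH10 U) :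
    (∀ᵐ x, x ∈ (U : Set (EuclideanSpace ℝ (Fin d)))ᶜ → sobolevFun u x = 0) ∧
      ∀ i, ∀ᵐ x, x ∈ (U : Set (EuclideanSpace ℝ (Fin d)))ᶜ → weakDeriv u i x = 0 := by
  have hcl := isClosed_setOf_ae_eq_zero_on (F := ℂ) (p := 2) (μ := volume)
    U.isOpen.measurableSet.compl
  exact ⟨closure_minimal (fun v hv => (ae_eq_zero_of_mem_testFunctionsH1 hv).1)
      (hcl.preimage continuous_sobolevFun) hu,
    fun i => closure_minimal (fun v hv => (ae_eq_zero_of_mem_testFunctionsH1 hv).2 i)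
      (hcl.preimage (continuous_weakDeriv i)) hu⟩

lemma isClosed_sobolevH10 (U : Opens (EuclideanSpace ℝ (Fin d))) :
    IsClosed (SobolevH10 U : Set (SobolevH1 d)) :=
  Submodule.isClosed_topologicalClosure _

lemma testFunctionsH1_mono : Monotone (testFunctionsH1 (d := d)) := by
  rintro U V hUV u ⟨φ, hφ⟩
  exact ⟨⟨φ, φ.contDiff, φ.hasCompactSupport, φ.tsupport_subset.trans hUV⟩, hφ⟩

lemma sobolevH10_mono : Monotone (SobolevH10 (d := d)) :=
  fun _ _ hUV => Submodule.topologicalClosure_mono (testFunctionsH1_mono hUV)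

variable {ι : Type*} {Ω : ι → Opens (EuclideanSpace ℝ (Fin d))}

lemma testFunctionsH1_iSup [Nonempty ι] (hΩ : Directed (· ≤ ·) Ω) :
    testFunctionsH1 (⨆ i, Ω i) = ⨆ i, testFunctionsH1 (Ω i) := by
  refine le_antisymm ?_ (iSup_le fun i => testFunctionsH1_mono (le_iSup Ω i))
  rintro u ⟨φ, hφ⟩
  obtain ⟨i, hi⟩ := φ.hasCompactSupport.isCompact.elim_directed_cover
    (fun i => (Ω i : Set (EuclideanSpace ℝ (Fin d)))) (fun i => (Ω i).isOpen)
    (φ.tsupport_subset.trans (Opens.coe_iSup Ω).subset) hΩ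
  exact Submodule.mem_iSup_of_mem i ⟨⟨φ, φ.contDiff, φ.hasCompactSupport, hi⟩, hφ⟩

lemma sobolevH10_iSup [Nonempty ι] (hΩ : Directed (· ≤ ·) Ω) :
    SobolevH10 (⨆ i, Ω i) = (⨆ i, SobolevH10 (Ω i)).topologicalClosure := by
  refine le_antisymm ?_ (Submodule.topologicalClosure_minimal _
    (iSup_le fun i => sobolevH10_mono (le_iSup Ω i)) (isClosed_sobolevH10 _))
  rw [SobolevH10, testFunctionsH1_iSup hΩ]
  exact Submodule.topologicalClosure_mono
    (iSup_mono fun i => Submodule.le_topologicalClosure (testFunctionsH1 (Ω i)))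

end Sobolev

section Dirichlet

variable {d : ℕ} {lam : ℝ}

/-- The map `u ↦ (√lam u, ∇u)`, which turns the Dirichlet form `lam ⟨u, v⟩ + ⟨∇u, ∇v⟩` into the
inner product of `L₂(ℝᵈ) × L₂(ℝᵈ)ᵈ`. -/
noncomputable def energyMap (d : ℕ) (lam : ℝ) : SobolevH1 d →L[ℂ] GraphSpace d :=
  (WithLp.prodContinuousLinearEquiv 2 ℂ _ _).symm.toContinuousLinearMap ∘L
    (((√lam : ℂ) • WithLp.fstL 2 ℂ _ _).prod (WithLp.sndL 2 ℂ _ _)) ∘L (SobolevH1 d).subtypeL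

/-- The vector `(g / √lam, 0)`, which represents the functional `v ↦ ⟨v, g⟩` on `H¹(ℝᵈ)` through
`energyMap d lam`. -/
noncomputable def loadVector (lam : ℝ) (g : L2Space d) : GraphSpace d :=
  WithLp.toLp 2 ((√lam : ℂ)⁻¹ • g, 0)

lemma energyMap_fst (u : SobolevH1 d) : (energyMap d lam u).fst = (√lam : ℂ) • sobolevFun u := rfl

lemma energyMap_snd (u : SobolevH1 d) : (energyMap d lam u).snd = u.1.snd := rfl

lemma inner_energyMap (hlam : 0 ≤ lam) (v u : SobolevH1 d) :
    inner ℂ (energyMap d lam v) (energyMap d lam u) =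
      lam * inner ℂ (sobolevFun v) (sobolevFun u) +
        ∑ i, inner ℂ (weakDeriv v i) (weakDeriv u i) := by
  have hsq : (√lam : ℂ) * √lam = lam := by rw [← Complex.ofReal_mul, Real.mul_self_sqrt hlam]
  rw [WithLp.prod_inner_apply, WithLp.ofLp_fst, WithLp.ofLp_fst, WithLp.ofLp_snd, WithLp.ofLp_snd,
    energyMap_fst, energyMap_fst, energyMap_snd, energyMap_snd, inner_smul_left, inner_smul_right,
    Complex.conj_ofReal, ← mul_assoc, hsq, PiLp.inner_apply]
  rfl

lemma inner_energyMap_loadVector (hlam : 0 < lam) (v : SobolevH1 d) (g : L2Space d) :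
    inner ℂ (energyMap d lam v) (loadVector lam g) = inner ℂ (sobolevFun v) g := by
  have hne : (√lam : ℂ) ≠ 0 := Complex.ofReal_ne_zero.2 (Real.sqrt_pos.2 hlam).ne'
  rw [WithLp.prod_inner_apply, WithLp.ofLp_fst, energyMap_fst, loadVector, inner_zero_right,
    add_zero, inner_smul_left, inner_smul_right, Complex.conj_ofReal, mul_inv_cancel_left₀ hne]

lemma norm_energyMap_sq (hlam : 0 ≤ lam) (u : SobolevH1 d) :
    ‖energyMap d lam u‖ ^ 2 = lam * ‖sobolevFun u‖ ^ 2 + ‖u.1.snd‖ ^ 2 := by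
  rw [WithLp.prod_norm_sq_eq_of_L2, energyMap_fst, energyMap_snd, norm_smul, Complex.norm_real,
    mul_pow, Real.norm_eq_abs, sq_abs, Real.sq_sqrt hlam]

lemma antilipschitzWith_energyMap (hlam : 0 < lam) :
    AntilipschitzWith (√(max 1 lam⁻¹)).toNNReal (energyMap d lam) := by
  refine (energyMap d lam).antilipschitz_of_bound fun u => ?_
  rw [Real.coe_toNNReal _ (Real.sqrt_nonneg _)]
  refine le_of_sq_le_sq ?_ (by positivity)
  set M := max 1 lam⁻¹
  have hM : 1 ≤ M := le_max_left _ _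
  have hMlam : 1 ≤ M * lam := (inv_le_iff_one_le_mul₀ hlam).1 (le_max_right _ _)
  calc ‖u‖ ^ 2 = ‖sobolevFun u‖ ^ 2 + ‖u.1.snd‖ ^ 2 := WithLp.prod_norm_sq_eq_of_L2 u.1
    _ ≤ M * lam * ‖sobolevFun u‖ ^ 2 + M * ‖u.1.snd‖ ^ 2 := by
      gcongr <;> exact le_mul_of_one_le_left (sq_nonneg _) ‹_›
    _ = (√M * ‖energyMap d lam u‖) ^ 2 := by
      rw [mul_pow, Real.sq_sqrt (by positivity), norm_energyMap_sq hlam.le]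
      ring

lemma isWeakDirichletSolution_iff_isLeastSquaresSolution (hlam : 0 < lam)
    {U : Opens (EuclideanSpace ℝ (Fin d))} {f : EuclideanSpace ℝ (Fin d) → ℂ} {g : L2Space d}
    (hg : ∀ᵐ x, x ∈ (U : Set (EuclideanSpace ℝ (Fin d))) → g x = f x) (u : SobolevH1 d) :
    IsWeakDirichletSolution U lam f u ↔
      IsLeastSquaresSolution (energyMap d lam) (loadVector lam g) (SobolevH10 U) u := by
  refine and_congr_right fun _ => forall₂_congr fun v hv => ?_
  obtain ⟨hv₀, hv₁⟩ := ae_eq_zero_of_mem_sobolevH10 hv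
  have hfg : ∫ x in (U : Set (EuclideanSpace ℝ (Fin d))), f x * (starRingEnd ℂ) (sobolevFun v x) =
      ∫ x in (U : Set (EuclideanSpace ℝ (Fin d))), g x * (starRingEnd ℂ) (sobolevFun v x) := by
    refine setIntegral_congr_ae U.isOpen.measurableSet ?_
    filter_upwards [hg] with x hx hxU
    rw [hx hxU]
  rw [hfg, inner_energyMap hlam.le, inner_energyMap_loadVector hlam,
    setIntegral_mul_conj_eq_inner _ _ _ hv₀, setIntegral_mul_conj_eq_inner _ _ _ hv₀,
    Finset.sum_congr rfl fun i _ => setIntegral_mul_conj_eq_inner _ _ _ (hv₁ i)]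

lemma existsUnique_isWeakDirichletSolution (hlam : 0 < lam)
    {U : Opens (EuclideanSpace ℝ (Fin d))} {f : EuclideanSpace ℝ (Fin d) → ℂ}
    (hf : MemLp f 2 (volume.restrict (U : Set (EuclideanSpace ℝ (Fin d))))) :
    ∃! u : SobolevH1 d, IsWeakDirichletSolution U lam f u := by
  obtain ⟨g, hg⟩ := exists_Lp_ae_eq_on U.isOpen.measurableSet hf
  simp_rw [isWeakDirichletSolution_iff_isLeastSquaresSolution hlam hg]
  exact existsUnique_isLeastSquaresSolution (antilipschitzWith_energyMap hlam) _
    (isClosed_sobolevH10 U)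

lemma tendsto_of_isWeakDirichletSolution {ι : Type*} [Preorder ι] [IsDirectedOrder ι] [Nonempty ι]
    {Ω : ι → Opens (EuclideanSpace ℝ (Fin d))} (hΩ : Monotone Ω) (hlam : 0 < lam)
    {f : EuclideanSpace ℝ (Fin d) → ℂ}
    (hf : MemLp f 2 (volume.restrict ((⨆ i, Ω i : Opens _) : Set (EuclideanSpace ℝ (Fin d)))))
    {u : ι → SobolevH1 d} {uLim : SobolevH1 d}
    (hu : ∀ i, IsWeakDirichletSolution (Ω i) lam f (u i))
    (huLim : IsWeakDirichletSolution (⨆ i, Ω i) lam f uLim) : Tendsto u atTop (𝓝 uLim) := by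
  obtain ⟨g, hg⟩ := exists_Lp_ae_eq_on (⨆ i, Ω i).isOpen.measurableSet hf
  have hgΩ : ∀ i, ∀ᵐ x, x ∈ (Ω i : Set (EuclideanSpace ℝ (Fin d))) → g x = f x :=
    fun i => hg.mono fun x hx hxi => hx (le_iSup Ω i hxi)
  rw [isWeakDirichletSolution_iff_isLeastSquaresSolution hlam hg,
    sobolevH10_iSup hΩ.directed_le] at huLim
  exact tendsto_of_isLeastSquaresSolution (sobolevH10_mono.comp hΩ)
    ((antilipschitzWith_energyMap hlam).isInducing (energyMap d lam).continuous)
    (fun i => (isWeakDirichletSolution_iff_isLeastSquaresSolution hlam (hgΩ i) (u i)).1 (hu i))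
    huLim

end Dirichlet

theorem corollary5p2_general {d : ℕ} {ι : Type*} [Preorder ι] [IsDirectedOrder ι] [Nonempty ι]
    (Ω : ι → Opens (EuclideanSpace ℝ (Fin d))) (hΩ : Monotone Ω) (lam : ℝ) (hlam : 0 < lam)
    (f : EuclideanSpace ℝ (Fin d) → ℂ)
    (hf : MemLp f 2 (volume.restrict (⋃ i, (Ω i : Set (EuclideanSpace ℝ (Fin d)))))) :
    (∀ i, ∃! u : SobolevH1 d, IsWeakDirichletSolution (Ω i) lam f u) ∧
    (∃! u : SobolevH1 d, IsWeakDirichletSolution (⨆ i, Ω i) lam f u) ∧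
    ∀ (u : ι → SobolevH1 d) (uLim : SobolevH1 d),
      (∀ i, IsWeakDirichletSolution (Ω i) lam f (u i)) →
      IsWeakDirichletSolution (⨆ i, Ω i) lam f uLim → Tendsto u atTop (𝓝 uLim) := by
  rw [← Opens.coe_iSup] at hf
  have hfΩ : ∀ i, MemLp f 2 (volume.restrict (Ω i : Set (EuclideanSpace ℝ (Fin d)))) :=
    fun i => hf.mono_measure (Measure.restrict_mono (le_iSup Ω i) le_rfl)
  exact ⟨fun i => existsUnique_isWeakDirichletSolution hlam (hfΩ i),
    existsUnique_isWeakDirichletSolution hlam hf,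
    fun _ _ => tendsto_of_isWeakDirichletSolution hΩ hlam hf⟩

theorem corollary5p2 {d : ℕ} (Ω : ℕ → Opens (EuclideanSpace ℝ (Fin d))) (hΩ : Monotone Ω)
    (lam : ℝ) (hlam : 0 < lam) (f : EuclideanSpace ℝ (Fin d) → ℂ)
    (hf : MemLp f 2 (volume.restrict (⋃ n, (Ω n : Set (EuclideanSpace ℝ (Fin d)))))) :
    (∀ n, ∃! u : SobolevH1 d, IsWeakDirichletSolution (Ω n) lam f u) ∧
    (∃! u : SobolevH1 d, IsWeakDirichletSolution (⨆ n, Ω n) lam f u) ∧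
    ∀ (u : ℕ → SobolevH1 d) (uLim : SobolevH1 d),
      (∀ n, IsWeakDirichletSolution (Ω n) lam f (u n)) →
      IsWeakDirichletSolution (⨆ n, Ω n) lam f uLim →
      Tendsto (fun n => ‖sobolevFun (u n) - sobolevFun uLim‖) atTop (𝓝 0) := by
  obtain ⟨existsUnique, existsUnique_iSup, tendsto⟩ := corollary5p2_general Ω hΩ lam hlam f hf
  exact ⟨existsUnique, existsUnique_iSup, fun u uLim hu huLim =>
    tendsto_iff_norm_sub_tendsto_zero.1
      ((continuous_sobolevFun.tendsto uLim).comp (tendsto u uLim hu huLim))⟩
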